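/- **Setting.** Let $p\ge 1$, $f(x)=\sum_{i=1}^p f_i(x_i)$, $\mathcal X=\prod_{i=1}^p X_i$, $A=[A_1,\dots,A_p]\in\mathbb R^{m\times n}$, $b\in\mathbb R^m$, where $x_i\in\mathbb R^{n_i}$, each $f_i:\mathbb R^{n_i}\to\mathbb R\cup\{+\infty\}$ is proper, closed and convex and each $X_i\subseteq\mathbb R^{n_i}$ is nonempty, closed and convex. Consider $$f^\star=\min\{f(x): Ax=b,\ x\in\mathcal X\},\qquad g(y)=\inf_{x\in\mathcal X}\{f(x)+y^T(Ax-b)\}\quad(y\in\mathbb R^m).$$ Assume that the minimum is attained and that either (i) $\mathcal X$ is a polytope and $Ax=b$ for some $x\in\mathcal X\cap\mathrm{relint}(\mathrm{dom} f)$, or (ii) $Ax=b$ for some $x\in\mathrm{relint}(\mathcal X\cap\mathrm{dom} f)$. (If $f$ is finite on $\mathbb R^n$, this says that $\mathcal X$ is a polytope or Slater's condition $\{Ax=b\}\cap\mathrm{relint}(\mathcal X)\ne\emptyset$ holds.) Let $\mathcal Y^\star$ be the set of maximizers of $g$ and $D_{\mathcal Y^\star}=\min\{\|y\|_2:y\in\mathcal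 Y^\star\}$. **Bregman distance.** Let $x^c\in\mathcal X$ and $\sigma>0$, let $S=\mathrm{diag}(S_1,\dots,S_p)$ be a block diagonal matrix with $S_p=\mathbb I$, and let $d(Sx,Sz)=\sum_{i=1}^p d_i(S_ix_i,S_iz_i)$, where $d_i(u,v)=h_i(u)-h_i(v)-\nabla h_i(v)^T(u-v)$ is the Bregman distance of a nonnegative function $h_i$ that is differentiable at the points of $S_iX_i$ and $\sigma$-strongly convex on $S_iX_i$. Let $D_{\mathcal X}^S=\sup_{x,z\in\mathcal X}d(Sx,Sz)$, assumed finite, and let $\bar L^g>0$ be a constant with $\|A(x-z)\|_2^2\le\sigma\bar L^g\|S(x-z)\|_2^2$ for all $x,z\in\mathcal X$ (for instance $\bar L^g=\sigma^{-1}\|A\|_2^2$ if $S=\mathbb I$ and $A\neq0$). For $\gamma>0$ let $x^\star_\gamma(y)$ denote a minimizer of $f(x)+y^T(Ax-b)+\gamma d(Sx,Sx^c)$ over $x\in\mathcal X$. **Last block.** Assume that $f_p$ is finite and differentiable on $\mathbb R^{n_p}$ with Lipschitz continuous gradient, that $\lambda_{\min}(A_p^TA_p)>0$, and that $h_p$ is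 differentiable on $\mathbb R^{n_p}$ with $1$-Lipschitz gradient. **Scheme (1P2D).** For $k\ge0$ let $\tau_k=\frac1{k+2}$, $\gamma_0=\beta_0=\sqrt{\bar L^g}$, $\gamma_{k+1}=\bigl(1-\frac{\tau_k}{1+\tau_k}\bigr)\gamma_k$ and $\beta_{k+1}=(1-\tau_k)\beta_k$. Let $$\hat y^k=(1-\tau_k)\bar y^k+\tau_k\beta_k^{-1}(A\bar x^k-b),\qquad \bar x^{k+1}=(1-\tau_k)\bar x^k+\tau_k x^\star_{\gamma_{k+1}}(\hat y^k),$$ $$\bar y^{k+1}=\hat y^k+\frac{\gamma_{k+1}}{\bar L^g}\bigl(Ax^\star_{\gamma_{k+1}}(\hat y^k)-b\bigr),$$ with the same minimizer $x^\star_{\gamma_{k+1}}(\hat y^k)$ in both formulas. The starting point is $\bar x^0=x^\star_{\gamma_0}(0)$, $\bar y^0=\beta_0^{-1}(A\bar x^0-b)$ or, if $\sigma=1$, alternatively $\bar y^0=\beta_0^{-1}(Ax^c-b)$ and $\bar x^0\in\arg\min_{x\in\mathcal X}\{f(x)+(\bar y^0)^TA(x-x^c)+\frac{\bar L^g}{2\beta_0}\|S(x-x^c)\|_2^2\}$.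 Assume that the constraint on the last block is not active in the subproblems solved: for every $k\ge0$ the minimum over $u\in\mathbb R^{n_p}$ of $f_p(u)+(\hat y^k)^TA_pu+\gamma_{k+1}d_p(u,x_p^c)$ is attained at a point of $X_p$. **Claim.** The set $\mathcal Y^\star$ is nonempty and $D_{\mathcal Y^\star}$ is attained. For every $k\ge0$ we have $\bar x^k\in\mathcal X$, $f(\bar x^k)<+\infty$ and $$\|A\bar x^k-b\|_2\le\frac{2\sqrt{2\bar L^g}\,\bigl(D_{\mathcal Y^\star}+\sqrt{D_{\mathcal X}^S}\bigr)}{k+1},\qquad -D_{\mathcal Y^\star}\|A\bar x^k-b\|_2\le f(\bar x^k)-f^\star\le\frac{2\sqrt{2\bar L^g}}{k+1}\,D_{\mathcal X}^S .$$ In particular no horizon has to be fixed in advance. -/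

import Mathlib

open scoped RealInnerProductSpace

noncomputable section

namespace SepConvex

/-- `ℝᵈ` with the Euclidean norm. -/
abbrev Vec (d : ℕ) : Type := EuclideanSpace ℝ (Fin d)

/-- A point of `ℝⁿ = ℝ^{n_1} × ⋯ × ℝ^{n_p}`, where `p = r + 1`, given by its blocks. -/
abbrev Blocks {r : ℕ} (n : Fin (r + 1) → ℕ) : Type := ∀ i, Vec (n i)

/-- The data of the separable problem `min { ∑ f_i(x_i) : ∑ A_i x_i = b, x_i ∈ X_i }` with
`p = r + 1` blocks. A function `f_i` with values in `ℝ ∪ {+∞}` is given by its domain `dom i`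
and by its (real) values `f i` there; the values of `f i` outside `dom i` are never used. -/
structure Problem (m r : ℕ) (n : Fin (r + 1) → ℕ) where
  f : ∀ i, Vec (n i) → ℝ
  dom : ∀ i, Set (Vec (n i))
  X : ∀ i, Set (Vec (n i))
  A : ∀ i, Matrix (Fin m) (Fin (n i)) ℝ
  b : Vec m

/-- A function with values in `ℝ ∪ {+∞}`, given by its domain `D` and its values `φ` on `D`, is
proper, closed and convex: `D` is nonempty, `φ` is convex on the convex set `D`, and the
epigraph is closed. -/
def IsProperClosedConvex {d : ℕ} (D : Set (Vec d)) (φ : Vec d → ℝ) : Prop :=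
  D.Nonempty ∧ ConvexOn ℝ D φ ∧ IsClosed {z : Vec d × ℝ | z.1 ∈ D ∧ φ z.1 ≤ z.2}

/-- The matrix `M` acting on column vectors. -/
def app {k d : ℕ} (M : Matrix (Fin k) (Fin d) ℝ) (u : Vec d) : Vec k :=
  Matrix.toEuclideanLin M u

namespace Problem

variable {m r : ℕ} {n : Fin (r + 1) → ℕ} (P : Problem m r n)

/-- The objective `f(x) = ∑ f_i(x_i)`. -/
def obj (x : Blocks n) : ℝ := ∑ i, P.f i (x i)

/-- The domain of `f`. -/
def domain : Set (Blocks n) := {x | ∀ i, x i ∈ P.dom i}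

/-- The set `𝒳 = ∏ X_i`. -/
def constraint : Set (Blocks n) := {x | ∀ i, x i ∈ P.X i}

/-- The residual `A x - b`. -/
def res (x : Blocks n) : Vec m := (∑ i, app (P.A i) (x i)) - P.b

/-- The points of `𝒳` with `A x = b` and `f(x) < +∞`. -/
def feasible : Set (Blocks n) := {x | x ∈ P.constraint ∩ P.domain ∧ P.res x = 0}

/-- The problem has an optimal solution. -/
def HasSolution : Prop := ∃ x ∈ P.feasible, IsMinOn P.obj P.feasible x

/-- The optimal value `f⋆`. -/
def optValue : ℝ := sInf (P.obj '' P.feasible)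

/-- The dual function `g(y) = inf { f(x) + yᵀ(A x - b) : x ∈ 𝒳 }`, with values in `[-∞, +∞]`. -/
def dualFun (y : Vec m) : EReal :=
  ⨅ x ∈ P.constraint ∩ P.domain, ((P.obj x + ⟪y, P.res x⟫ : ℝ) : EReal)

/-- The set `𝒴⋆` of the maximizers of the dual function. -/
def dualSolutions : Set (Vec m) := {y | ∀ z, P.dualFun z ≤ P.dualFun y}

/-- `D_{𝒴⋆}`, the norm of a minimum norm dual solution. -/
def dualRadius : ℝ := sInf ((fun y => ‖y‖) '' P.dualSolutions)

/-- The standing assumption: each `f_i` is proper, closed and convex, each `X_i` is nonempty,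
closed and convex, there is an optimal solution, and either `𝒳` is a polytope, or `A x = b` holds
at some point of the relative interior of `𝒳`. The domain of `f` is taken into account in both
cases; where `f` is finite on all of `ℝⁿ`, the two cases are exactly those just named. -/
def Standing : Prop :=
  (∀ i, IsProperClosedConvex (P.dom i) (P.f i)) ∧
  (∀ i, (P.X i).Nonempty ∧ IsClosed (P.X i) ∧ Convex ℝ (P.X i)) ∧
  P.HasSolution ∧
  (((∃ s : Set (Blocks n), s.Finite ∧ P.constraint = convexHull ℝ s) ∧
      ∃ x ∈ P.constraint, x ∈ intrinsicInterior ℝ P.domain ∧ P.res x = 0) ∨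
    ∃ x ∈ intrinsicInterior ℝ (P.constraint ∩ P.domain), P.res x = 0)

end Problem

/-- `φ` is differentiable on `ℝᵈ` and `∇φ` is Lipschitz continuous with constant `L`. -/
def IsLipschitzGradient {d : ℕ} (L : NNReal) (φ : Vec d → ℝ) : Prop :=
  Differentiable ℝ φ ∧ LipschitzWith L (gradient φ)

/-- The Bregman distance `h(u) - h(v) - ∇h(v)ᵀ(u - v)`. -/
def bregman {d : ℕ} (h : Vec d → ℝ) (u v : Vec d) : ℝ :=
  h u - h v - ⟪gradient h v, u - v⟫

/-- `h` is a smooth prox-function of `K` with strong convexity parameter `σ` (its continuity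
follows from its differentiability). -/
def IsProxFunction {d : ℕ} (h : Vec d → ℝ) (K : Set (Vec d)) (σ : ℝ) : Prop :=
  (∀ u ∈ K, 0 ≤ h u) ∧ StrongConvexOn K σ h ∧ ∀ u ∈ K, DifferentiableAt ℝ h u

/-- The data of a separable Bregman distance: for each of the first `r = p - 1` blocks a matrix
`S_i` and a prox-function, for the last block a prox-function only (its matrix is the identity),
and the prox-center `x^c`. -/
structure Smoother {r : ℕ} (n : Fin (r + 1) → ℕ) where
  q : Fin r → ℕ
  S : ∀ i : Fin r, Matrix (Fin (q i)) (Fin (n i.castSucc)) ℝ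
  h : ∀ i : Fin r, Vec (q i) → ℝ
  hLast : Vec (n (Fin.last r)) → ℝ
  center : Blocks n

namespace Smoother

variable {m r : ℕ} {n : Fin (r + 1) → ℕ} (B : Smoother n)

/-- The Bregman distance `d(S x, S z) = ∑ d_i(S_i x_i, S_i z_i)`, where `S_p` is the identity. -/
def dist (x z : Blocks n) : ℝ :=
  (∑ i : Fin r, bregman (B.h i) (app (B.S i) (x i.castSucc)) (app (B.S i) (z i.castSucc))) +
    bregman B.hLast (x (Fin.last r)) (z (Fin.last r))

/-- The square `‖S x‖²` of the Euclidean norm of `S x`. -/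
def normSqS (x : Blocks n) : ℝ :=
  (∑ i : Fin r, ‖app (B.S i) (x i.castSucc)‖ ^ 2) + ‖x (Fin.last r)‖ ^ 2

/-- The values `d(S x, S z)` for `x` and `z` in `𝒳`. -/
def proxValues (P : Problem m r n) : Set ℝ :=
  {t | ∃ x ∈ P.constraint, ∃ z ∈ P.constraint, t = B.dist x z}

/-- The projected prox-diameter `D_𝒳^S`. -/
def proxDiameter (P : Problem m r n) : ℝ := sSup (B.proxValues P)

/-- The center lies in `𝒳`, and the functions that define the Bregman distance are smooth
`σ`-strongly convex prox-functions of the sets `S_i X_i`. -/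
def IsSmoother (P : Problem m r n) (σ : ℝ) : Prop :=
  B.center ∈ P.constraint ∧
  (∀ i : Fin r, IsProxFunction (B.h i) (app (B.S i) '' P.X i.castSucc) σ) ∧
  IsProxFunction B.hLast (P.X (Fin.last r)) σ

/-- `L` is an admissible constant `L̄ᵍ`: `‖A(x - z)‖² ≤ σ L ‖S(x - z)‖²` for `x, z ∈ 𝒳`. For
`S = I` and `A ≠ 0` this holds with `L = σ⁻¹‖A‖²`. -/
def IsSmoothingConstant (P : Problem m r n) (σ L : ℝ) : Prop :=
  0 < L ∧ ∀ x ∈ P.constraint, ∀ z ∈ P.constraint,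
    ‖P.res x - P.res z‖ ^ 2 ≤ σ * L * B.normSqS (x - z)

/-- `x` is a point `x⋆_γ(y)`: a minimizer of `f(x) + yᵀ(A x - b) + γ d(S x, S x^c)` over `𝒳`. -/
def IsSmoothedMin (P : Problem m r n) (γ : ℝ) (y : Vec m) (x : Blocks n) : Prop :=
  x ∈ P.constraint ∩ P.domain ∧
  IsMinOn (fun z => P.obj z + ⟪y, P.res z⟫ + γ * B.dist z B.center)
    (P.constraint ∩ P.domain) x

/-- `x` is a value of the proximal step at `(x^c, y)` with parameter `β`: a minimizer of
`f(x) + yᵀA(x - x^c) + (L/(2β)) ‖S(x - x^c)‖²` over `𝒳`. -/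
def IsProxStep (P : Problem m r n) (L β : ℝ) (y : Vec m) (x : Blocks n) : Prop :=
  x ∈ P.constraint ∩ P.domain ∧
  IsMinOn (fun z => P.obj z + ⟪y, P.res z - P.res B.center⟫ +
      L / (2 * β) * B.normSqS (z - B.center))
    (P.constraint ∩ P.domain) x

/-- The constraint `x_p ∈ X_p` on the last block is not active in the subproblem with parameters
`γ` and `y`: the minimum of `f_p(u) + yᵀA_p u + γ d_p(u, x_p^c)` over the whole space is attained
in `X_p`. -/
def LastInactive (P : Problem m r n) (γ : ℝ) (y : Vec m) : Prop :=
  ∃ u ∈ P.X (Fin.last r),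
    IsMinOn (fun v => P.f (Fin.last r) v + ⟪y, app (P.A (Fin.last r)) v⟫ +
      γ * bregman B.hLast v (B.center (Fin.last r))) Set.univ u

end Smoother

/-- The step size `τ_k = 1/(k+2)`. -/
def tau (k : ℕ) : ℝ := 1 / ((k : ℝ) + 2)

/-- `γ_0 = √L` and `γ_{k+1} = (1 - τ_k/(1 + τ_k)) γ_k`. -/
def gam (L : ℝ) : ℕ → ℝ
  | 0 => √L
  | k + 1 => (1 - tau k / (1 + tau k)) * gam L k

/-- `β_0 = √L` and `β_{k+1} = (1 - τ_k) β_k`. -/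
def bet (L : ℝ) : ℕ → ℝ
  | 0 => √L
  | k + 1 => (1 - tau k) * bet L k

namespace Smoother

variable {m r : ℕ} {n : Fin (r + 1) → ℕ} (B : Smoother n)

/-- The point `ŷᵏ = (1 - τ_k) yᵏ + τ_k β_k⁻¹ (A xᵏ - b)`. -/
def yHat (P : Problem m r n) (L : ℝ) (x : ℕ → Blocks n) (y : ℕ → Vec m) (k : ℕ) : Vec m :=
  (1 - tau k) • y k + tau k • ((bet L k)⁻¹ • P.res (x k))

/-- The starting point: either `x⁰ = x⋆_{γ_0}(0)` and `y⁰ = β_0⁻¹(A x⁰ - b)`, or, for a Bregman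
distance with `σ = 1`, `y⁰ = β_0⁻¹(A x^c - b)` and `x⁰` is the proximal step at `(x^c, y⁰)`. -/
def IsStart (P : Problem m r n) (σ L : ℝ) (x₀ : Blocks n) (y₀ : Vec m) : Prop :=
  (B.IsSmoothedMin P (gam L 0) 0 x₀ ∧ y₀ = (bet L 0)⁻¹ • P.res x₀) ∨
  (σ = 1 ∧ y₀ = (bet L 0)⁻¹ • P.res B.center ∧ B.IsProxStep P L (bet L 0) y₀ x₀)

/-- The sequences `x`, `y` are generated by the scheme with one primal and two dual steps. -/
def IsGenerated (P : Problem m r n) (σ L : ℝ) (x : ℕ → Blocks n) (y : ℕ → Vec m) : Prop :=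
  B.IsStart P σ L (x 0) (y 0) ∧
  ∀ k, ∃ xs, B.IsSmoothedMin P (gam L (k + 1)) (yHat P L x y k) xs ∧
    x (k + 1) = (1 - tau k) • x k + tau k • xs ∧
    y (k + 1) = yHat P L x y k + (gam L (k + 1) / L) • P.res xs

end Smoother

end SepConvex

end

/-! The proof has two independent halves. The first is strong duality with attainment. A
Hoffman-type error bound for the constraints (`exists_errorBound_convexHull` for a polytope,
`exists_errorBound_affineSubspace` under the Slater condition) shows that the optimal value drops at
most linearly in the residual `A x - b` (`exists_calm_of_errorBound`). Hahn–Banach separation then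
yields a Lagrange multiplier (`exists_multiplier_of_calm`), and the maximizers of `g` are exactly
the multipliers: a nonempty closed set, hence one with an element of least norm.

The second is Nesterov's excessive gap invariant `f(xᵏ) + ‖A xᵏ - b‖² / (2 β_k) ≤ g_{γ_k}(yᵏ)`. It
holds at the start because `γ_0 β_0 = L`, and one step preserves it (`ExcessiveGap.step`) because
the smoothed dual function lies above a quadratic model with curvature `L / γ`.

Evaluating the right side at an optimal solution gives `f(xᵏ) - f⋆ + ‖A xᵏ - b‖² / (2 β_k) ≤ γ_k D`,
where `D` is the prox-diameter. A multiplier of least norm bounds `f(xᵏ) - f⋆` below by `-‖y‖ ‖A xᵏ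
- b‖`. The residual thus satisfies a quadratic inequality, and the rates follow since `β_k` and
`γ_k` are of order `√L / k`. -/

namespace SepConvex

/-! ### Hoffman error bounds. -/

section ErrorBound

variable {E W : Type*} [NormedAddCommGroup E] [NormedSpace ℝ E]

/-- Two points of a polytope: the first lies on a segment joining the second to a point of the
convex hull of a proper subset of the generators. -/
theorem exists_erase_of_mem_convexHull [DecidableEq E] {s : Finset E} {x z : E}
    (hx : x ∈ convexHull ℝ (s : Set E)) (hz : z ∈ convexHull ℝ (s : Set E)) (hxz : x ≠ z) :
    ∃ p ∈ s, ∃ v ∈ convexHull ℝ ((s.erase p : Finset E) : Set E), ∃ t : ℝ, 0 ≤ t ∧ t < 1 ∧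
      x = t • z + (1 - t) • v := by
  obtain ⟨a, ha, ha1, rfl⟩ := Finset.mem_convexHull'.1 hx
  obtain ⟨c, hc, hc1, rfl⟩ := Finset.mem_convexHull'.1 hz
  have hne : (s.filter fun q => 0 < c q).Nonempty := by
    by_contra h
    rw [Finset.not_nonempty_iff_eq_empty, Finset.filter_eq_empty_iff] at h
    have : ∑ q ∈ s, c q ≤ 0 := Finset.sum_nonpos fun q hq => not_lt.1 (h hq)
    linarith
  -- Ratio test: the least ratio `t` is the largest number for which `x - t z` keeps nonnegative
  -- coefficients, and the coefficient at `p` vanishes. Normalizing `x - t z` by `1 - t` gives `v`.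
  obtain ⟨p, hp, hmin⟩ := Finset.exists_min_image _ (fun q => a q / c q) hne
  rw [Finset.mem_filter] at hp
  obtain ⟨hps, hcp⟩ := hp
  set t := a p / c p with ht
  have ht0 : 0 ≤ t := div_nonneg (ha p hps) hcp.le
  have hle : ∀ q ∈ s, t * c q ≤ a q := by
    intro q hq
    rcases (hc q hq).eq_or_lt with h0 | h0
    · rw [← h0, mul_zero]; exact ha q hq
    · exact (le_div_iff₀ h0).1 (hmin q (Finset.mem_filter.2 ⟨hq, h0⟩))
  have ht1 : t ≤ 1 := by
    have := Finset.sum_le_sum hle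
    rwa [← Finset.mul_sum, hc1, ha1, mul_one] at this
  have htne : t ≠ 1 := by
    intro h1
    apply hxz
    have heq : ∀ q ∈ s, c q = a q := by
      apply (Finset.sum_eq_sum_iff_of_le fun q hq => by simpa [h1] using hle q hq).1
      rw [hc1, ha1]
    exact Finset.sum_congr rfl fun q hq => by rw [heq q hq]
  have ht1' : 0 < 1 - t := sub_pos.2 (lt_of_le_of_ne ht1 htne)
  have hp0 : (1 - t)⁻¹ * (a p - t * c p) = 0 := by
    rw [ht, div_mul_cancel₀ _ hcp.ne', sub_self, mul_zero]
  refine ⟨p, hps, ∑ q ∈ s.erase p, ((1 - t)⁻¹ * (a q - t * c q)) • q,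
    Finset.mem_convexHull'.2 ⟨_, fun q hq => ?_, ?_, rfl⟩, t, ht0, by linarith, ?_⟩
  · exact mul_nonneg (inv_nonneg.2 ht1'.le) (sub_nonneg.2 (hle q (Finset.mem_of_mem_erase hq)))
  · rw [Finset.sum_erase (f := fun q => (1 - t)⁻¹ * (a q - t * c q)) _ hp0, ← Finset.mul_sum, Finset.sum_sub_distrib, ← Finset.mul_sum, ha1,
      hc1, mul_one, inv_mul_cancel₀ ht1'.ne']
  · rw [Finset.sum_erase _ (by rw [hp0, zero_smul]), Finset.smul_sum, Finset.smul_sum,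
      ← Finset.sum_add_distrib]
    refine Finset.sum_congr rfl fun q _ => ?_
    rw [smul_smul, smul_smul, ← mul_assoc, mul_inv_cancel₀ ht1'.ne', one_mul, ← add_smul]
    congr 1; ring

variable [NormedAddCommGroup W] [NormedSpace ℝ W]

theorem affineMap_combo (T : E →ᵃ[ℝ] W) {a c : ℝ} (h : a + c = 1) (x z : E) :
    T (a • x + c • z) = a • T x + c • T z := by
  simpa using Convex.combo_affine_apply (f := T) (x := x) (y := z) h

variable [FiniteDimensional ℝ E]

/-- Hoffman's error bound for the intersection of a polytope with an affine subspace and the zero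
set of an affine map. -/
theorem exists_errorBound_convexHull (T : E →ᵃ[ℝ] W) (M : AffineSubspace ℝ E) (s : Finset E) :
    ∀ z₀ ∈ convexHull ℝ (s : Set E), z₀ ∈ M → T z₀ = 0 →
    ∃ H : ℝ, 0 ≤ H ∧ ∀ x ∈ convexHull ℝ (s : Set E), x ∈ M →
      ∃ z ∈ convexHull ℝ (s : Set E), z ∈ M ∧ T z = 0 ∧ ‖x - z‖ ≤ H * ‖T x‖ := by
  classical
  induction s using Finset.strongInduction with
  | H s ih =>
  intro z₀ hz₀ hz₀M hTz₀
  have hT : Continuous T := T.continuous_of_finiteDimensional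
  have hconv : Convex ℝ (convexHull ℝ (s : Set E)) := convex_convexHull ℝ _
  have key : ∀ p ∈ s, ∃ H : ℝ, 0 ≤ H ∧ ∀ v ∈ convexHull ℝ ((s.erase p : Finset E) : Set E),
      v ∈ M → ∃ z ∈ convexHull ℝ (s : Set E), z ∈ M ∧ T z = 0 ∧ ‖v - z‖ ≤ H * ‖T v‖ := by
    intro p hp
    have hsub : convexHull ℝ ((s.erase p : Finset E) : Set E) ⊆ convexHull ℝ (s : Set E) :=
      convexHull_mono (Finset.coe_subset.2 (Finset.erase_subset _ _))
    -- If the smaller hull contains a solution, induction applies. Otherwise `‖T v‖` is bounded away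
    -- from zero there by compactness, and the fixed solution `z₀` is close enough.
    by_cases hz : ∃ z ∈ convexHull ℝ ((s.erase p : Finset E) : Set E), z ∈ M ∧ T z = 0
    · obtain ⟨z, hz, hzM, hTz⟩ := hz
      obtain ⟨H, hH, h⟩ := ih _ (Finset.erase_ssubset hp) z hz hzM hTz
      refine ⟨H, hH, fun v hv hvM => ?_⟩
      obtain ⟨w, hw, h'⟩ := h v hv hvM
      exact ⟨w, hsub hw, h'⟩
    · push Not at hz
      have hK : IsCompact (convexHull ℝ ((s.erase p : Finset E) : Set E) ∩ M) :=
        ((s.erase p).finite_toSet.isCompact_convexHull ℝ).inter_right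
          (AffineSubspace.closed_of_finiteDimensional M)
      rcases (convexHull ℝ ((s.erase p : Finset E) : Set E) ∩ M).eq_empty_or_nonempty with h | h
      · refine ⟨0, le_rfl, fun v hv hvM => ?_⟩
        have : v ∈ (convexHull ℝ ((s.erase p : Finset E) : Set E) ∩ M) := ⟨hv, hvM⟩
        rw [h] at this
        exact this.elim
      · obtain ⟨u, ⟨hu, huM⟩, hmin⟩ := hK.exists_isMinOn h hT.norm.continuousOn
        have hu0 : 0 < ‖T u‖ := norm_pos_iff.2 (hz u hu huM)
        obtain ⟨w, -, hmax⟩ := hK.exists_isMaxOn h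
          (f := fun u => ‖u - z₀‖) (by fun_prop)
        refine ⟨‖w - z₀‖ / ‖T u‖, by positivity, fun v hv hvM => ⟨z₀, hz₀, hz₀M, hTz₀, ?_⟩⟩
        rw [div_mul_eq_mul_div, le_div_iff₀ hu0]
        exact mul_le_mul (hmax ⟨hv, hvM⟩) (hmin ⟨hv, hvM⟩) (norm_nonneg _) (norm_nonneg _)
  choose! H hH0 hH using key
  refine ⟨∑ p ∈ s, H p, Finset.sum_nonneg hH0, fun x hx hxM => ?_⟩
  rcases eq_or_ne x z₀ with rfl | hne
  · exact ⟨x, hx, hxM, hTz₀, by simp [hTz₀]⟩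
  -- As `T z₀ = 0`, moving from `v` to `x` scales the residual by `1 - t`. Replacing `v` by its
  -- nearby solution `z` in the combination scales the displacement by the same factor, so the
  -- constant is kept.
  obtain ⟨p, hp, v, hv, t, ht0, ht1, rfl⟩ := exists_erase_of_mem_convexHull hx hz₀ hne
  have ht : 0 < 1 - t := sub_pos.2 ht1
  have hvM : v ∈ M := by
    have h1 : v = AffineMap.lineMap z₀ (t • z₀ + (1 - t) • v) (1 - t)⁻¹ := by
      have : t • z₀ + (1 - t) • v - z₀ = (1 - t) • (v - z₀) := by module
      rw [AffineMap.lineMap_apply, vsub_eq_sub, vadd_eq_add, this, smul_smul,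
        inv_mul_cancel₀ ht.ne', one_smul, sub_add_cancel]
    rw [h1]
    exact AffineMap.lineMap_mem _ hz₀M hxM
  obtain ⟨z, hz, hzM, hTz, hle⟩ := hH p hp v hv hvM
  refine ⟨t • z₀ + (1 - t) • z, hconv hz₀ hz ht0 ht.le (by ring),
    M.convex hz₀M hzM ht0 ht.le (by ring), ?_, ?_⟩
  · rw [affineMap_combo T (by ring), hTz₀, hTz, smul_zero, smul_zero, add_zero]
  · have h1 : t • z₀ + (1 - t) • v - (t • z₀ + (1 - t) • z) = (1 - t) • (v - z) := by module
    rw [h1, affineMap_combo T (by ring), hTz₀, smul_zero, zero_add, norm_smul, norm_smul,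
      mul_left_comm]
    refine mul_le_mul_of_nonneg_left (hle.trans ?_) (norm_nonneg _)
    exact mul_le_mul_of_nonneg_right (Finset.single_le_sum hH0 hp) (norm_nonneg _)

/-- The error bound for an affine subspace and the zero set of an affine map. -/
theorem exists_errorBound_affineSubspace (T : E →ᵃ[ℝ] W) (M : AffineSubspace ℝ E) {x₀ : E}
    (hx₀ : x₀ ∈ M) (hT : T x₀ = 0) :
    ∃ H : ℝ, 0 ≤ H ∧ ∀ x ∈ M, ∃ z ∈ M, T z = 0 ∧ ‖x - z‖ ≤ H * ‖T x‖ := by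
  let l : M.direction →ₗ[ℝ] W := T.linear.comp M.direction.subtype
  -- A linear right inverse on the range is bounded in finite dimension; its norm is the constant.
  obtain ⟨g, hg⟩ := l.rangeRestrict.exists_rightInverse_of_surjective
    (LinearMap.range_rangeRestrict l)
  let G : LinearMap.range l →L[ℝ] M.direction := LinearMap.toContinuousLinearMap g
  refine ⟨‖G‖, norm_nonneg G, fun x hx => ?_⟩
  have hd : x - x₀ ∈ M.direction := AffineSubspace.vsub_mem_direction hx hx₀
  let d : M.direction := ⟨x - x₀, hd⟩
  have hld : l d = T x := by
    have := T.linearMap_vsub x x₀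
    simp only [vsub_eq_sub, hT, sub_zero] at this
    exact this
  let w : M.direction := g (l.rangeRestrict d)
  have hlw : l w = T x := by
    have := congrArg Subtype.val (LinearMap.congr_fun hg (l.rangeRestrict d))
    simpa [hld] using this
  refine ⟨x - w, ?_, ?_, ?_⟩
  · have := AffineSubspace.vadd_mem_of_mem_direction (M.direction.neg_mem w.2) hx
    rwa [vadd_eq_add, neg_add_eq_sub] at this
  · have h1 : x - (w : E) = -(w : E) +ᵥ x := by rw [vadd_eq_add, neg_add_eq_sub]
    rw [h1, T.map_vadd, map_neg, vadd_eq_add]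
    change -(l w) + T x = 0
    rw [hlw, neg_add_cancel]
  · rw [sub_sub_cancel]
    have h2 : ‖G (l.rangeRestrict d)‖ ≤ ‖G‖ * ‖l.rangeRestrict d‖ := G.le_opNorm _
    have h3 : ‖l.rangeRestrict d‖ = ‖T x‖ := by rw [← hld]; rfl
    rw [h3] at h2
    exact h2

end ErrorBound

/-! ### Linear lower bounds on the perturbed optimal value. -/

section CalmProgram

variable {E W : Type*} [NormedAddCommGroup E] [NormedSpace ℝ E] [FiniteDimensional ℝ E]

/-- A convex function is bounded above near a point of the relative interior of its domain. -/
theorem exists_ball_le_of_mem_intrinsicInterior {D : Set E} {φ : E → ℝ} (hφ : ConvexOn ℝ D φ)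
    {x₀ : E} (hx₀ : x₀ ∈ intrinsicInterior ℝ D) :
    ∃ δ > 0, ∃ C : ℝ, ∀ w ∈ (affineSpan ℝ D).direction, ‖w‖ ≤ δ → x₀ + w ∈ D ∧ φ (x₀ + w) ≤ C := by
  set M := affineSpan ℝ D with hM
  obtain ⟨y, hy, rfl⟩ := mem_intrinsicInterior.1 hx₀
  let j : M.direction → M := fun w =>
    ⟨(w : E) + (y : E), AffineSubspace.vadd_mem_of_mem_direction w.2 y.2⟩
  have hj : Continuous j := by
    exact (continuous_subtype_val.add continuous_const).subtype_mk _
  let D₀ : Set M.direction := {w | (w : E) + (y : E) ∈ D}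
  let g : M.direction → ℝ := fun w => φ ((w : E) + (y : E))
  have hint : (0 : M.direction) ∈ interior D₀ := by
    have h1 : j ⁻¹' interior (((↑) : M → E) ⁻¹' D) ⊆ D₀ := fun w hw =>
      interior_subset (s := ((↑) : M → E) ⁻¹' D) hw
    refine interior_maximal h1 (isOpen_interior.preimage hj) ?_
    have h0 : j 0 = y := Subtype.ext (zero_add _)
    rwa [Set.mem_preimage, h0]
  have hcomb : ∀ (u v : M.direction) (a c : ℝ), a + c = 1 →
      ((a • u + c • v : M.direction) : E) + (y : E) =
        a • ((u : E) + (y : E)) + c • ((v : E) + (y : E)) := by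
    intro u v a c h
    have : (y : E) = (a + c) • (y : E) := by rw [h, one_smul]
    rw [Submodule.coe_add, Submodule.coe_smul, Submodule.coe_smul]
    conv_lhs => rw [this]
    module
  have hg : ConvexOn ℝ D₀ g := by
    refine ⟨fun u hu v hv a c ha hc h => ?_, fun u hu v hv a c ha hc h => ?_⟩
    · change _ ∈ D
      rw [hcomb u v a c h]
      exact hφ.1 hu hv ha hc h
    · change φ _ ≤ _
      rw [hcomb u v a c h]
      exact hφ.2 hu hv ha hc h
  have hcont : ContinuousAt g 0 :=
    hg.continuousOn_interior.continuousAt (isOpen_interior.mem_nhds hint)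
  have hev : ∀ᶠ w in nhds (0 : M.direction), w ∈ D₀ ∧ g w < g 0 + 1 :=
    (Filter.eventually_mem_set.2 (mem_interior_iff_mem_nhds.1 hint)).and (hcont.eventually_lt_const (by linarith))
  obtain ⟨δ, hδ, hball⟩ := Metric.eventually_nhds_iff.1 hev
  refine ⟨δ / 2, by positivity, g 0 + 1, fun w hw hwδ => ?_⟩
  have := @hball ⟨w, hw⟩ (by rw [dist_zero_right]; change ‖w‖ < δ; linarith)
  rw [add_comm]
  exact ⟨this.1, this.2.le⟩

variable [NormedAddCommGroup W] [NormedSpace ℝ W]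

/-- Under an error bound for the constraints, the value of a convex program with an affine
constraint decreases at most linearly under perturbations of this constraint. -/
theorem exists_calm_of_errorBound {D Q : Set E} {φ : E → ℝ} (hφ : ConvexOn ℝ D φ)
    (hQ : Convex ℝ Q) (T : E →ᵃ[ℝ] W) {x₀ : E} (hx₀Q : x₀ ∈ Q)
    (hx₀ : x₀ ∈ intrinsicInterior ℝ D) (hTx₀ : T x₀ = 0) {H : ℝ}
    (hH : ∀ x ∈ Q, x ∈ affineSpan ℝ D →
      ∃ z ∈ Q, z ∈ affineSpan ℝ D ∧ T z = 0 ∧ ‖x - z‖ ≤ H * ‖T x‖)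
    {v : ℝ} (hv : ∀ x ∈ Q ∩ D, T x = 0 → v ≤ φ x) :
    ∃ K : ℝ, 0 ≤ K ∧ ∀ x ∈ Q ∩ D, v - K * ‖T x‖ ≤ φ x := by
  obtain ⟨δ, hδ, C, hC⟩ := exists_ball_le_of_mem_intrinsicInterior hφ hx₀
  have hx₀D : x₀ ∈ D := intrinsicInterior_subset hx₀
  have hvC : v ≤ C := (hv x₀ ⟨hx₀Q, hx₀D⟩ hTx₀).trans (by
    simpa using (hC 0 (Submodule.zero_mem _) (by simpa using hδ.le)).2)
  refine ⟨|H| / δ * (C - v), mul_nonneg (by positivity) (sub_nonneg.2 hvC), ?_⟩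
  rintro x ⟨hxQ, hxD⟩
  obtain ⟨z, hzQ, hzM, hTz, hle⟩ := hH x hxQ (subset_affineSpan ℝ D hxD)
  rcases eq_or_ne x z with rfl | hne
  · simpa [hTz] using hv x ⟨hxQ, hxD⟩ hTz
  have hw0 : 0 < ‖z - x‖ := norm_pos_iff.2 (sub_ne_zero.2 hne.symm)
  -- The solution `z` near `x` may lie outside `D`. The point `p`, at distance `δ` from `x₀` in the
  -- direction `z - x`, is in `D`, and `θ` is chosen so that `(x + θ p) / (1 + θ) = (z + θ x₀) / (1
  -- + θ)`. The left form puts this point in `D`, the right form in `Q` with zero residual.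
  set θ := ‖z - x‖ / δ with hθ
  have hθ0 : 0 < θ := div_pos hw0 hδ
  have hdir : θ⁻¹ • (z - x) ∈ (affineSpan ℝ D).direction :=
    Submodule.smul_mem _ _ (AffineSubspace.vsub_mem_direction hzM (subset_affineSpan ℝ D hxD))
  obtain ⟨hpD, hpC⟩ := hC _ hdir (by
    rw [norm_smul, norm_inv, Real.norm_of_nonneg hθ0.le, hθ, inv_div, div_mul_cancel₀ _ hw0.ne'])
  set p := x₀ + θ⁻¹ • (z - x) with hp
  have h1θ : 0 < 1 + θ := by linarith
  have ha : 0 ≤ 1 / (1 + θ) := by positivity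
  have hc : 0 ≤ θ / (1 + θ) := by positivity
  have hac : 1 / (1 + θ) + θ / (1 + θ) = 1 := by field_simp
  have hpt : (1 / (1 + θ)) • x + (θ / (1 + θ)) • p = (1 / (1 + θ)) • z + (θ / (1 + θ)) • x₀ := by
    have : θ / (1 + θ) * θ⁻¹ = 1 / (1 + θ) := by field_simp
    rw [hp, smul_add, smul_smul, this]
    module
  have hq1 : (1 / (1 + θ)) • x + (θ / (1 + θ)) • p ∈ D := hφ.1 hxD hpD ha hc hac
  have hq2 : (1 / (1 + θ)) • x + (θ / (1 + θ)) • p ∈ Q := by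
    rw [hpt]; exact hQ hzQ hx₀Q ha hc hac
  have hq3 : T ((1 / (1 + θ)) • x + (θ / (1 + θ)) • p) = 0 := by
    rw [hpt, affineMap_combo T hac, hTz, hTx₀, smul_zero, smul_zero, add_zero]
  have h1 := (hv _ ⟨hq2, hq1⟩ hq3).trans (hφ.2 hxD hpD ha hc hac)
  have h2 : v ≤ (φ x + θ * C) / (1 + θ) := by
    refine h1.trans ?_
    rw [smul_eq_mul, smul_eq_mul, add_div, div_mul_eq_mul_div, div_mul_eq_mul_div, one_mul]
    gcongr
  rw [le_div_iff₀ h1θ] at h2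
  have h3 : θ ≤ |H| / δ * ‖T x‖ := by
    rw [hθ, div_mul_eq_mul_div]
    gcongr
    rw [norm_sub_rev]
    exact hle.trans (mul_le_mul_of_nonneg_right (le_abs_self _) (norm_nonneg _))
  nlinarith [mul_le_mul_of_nonneg_right h3 (sub_nonneg.2 hvC)]

end CalmProgram

/-! ### Lagrange multipliers by separation. -/

section Multiplier

variable {E W : Type*} [NormedAddCommGroup E] [NormedSpace ℝ E] [NormedAddCommGroup W]
  [InnerProductSpace ℝ W] [FiniteDimensional ℝ W]

/-- A convex program with an affine constraint whose value function decreases at most linearly has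
a Lagrange multiplier. -/
theorem exists_multiplier_of_calm {C : Set E} {φ : E → ℝ} (hφ : ConvexOn ℝ C φ)
    (hne : C.Nonempty) (T : E →ᵃ[ℝ] W) {v K : ℝ} (hK0 : 0 ≤ K)
    (hK : ∀ x ∈ C, v - K * ‖T x‖ ≤ φ x) :
    ∃ y : W, ∀ x ∈ C, v ≤ φ x + ⟪y, T x⟫ := by
  let A₁ : Set (W × ℝ) := {q | q.2 < -(K * ‖q.1‖)}
  let A₂ : Set (W × ℝ) := {q | ∃ x ∈ C, q.1 = T x ∧ φ x - v ≤ q.2}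
  have hA₁ : Convex ℝ A₁ := by
    intro p hp q hq a c ha hc hac
    have hp' : p.2 < -(K * ‖p.1‖) := hp
    have hq' : q.2 < -(K * ‖q.1‖) := hq
    change a * p.2 + c * q.2 < -(K * ‖a • p.1 + c • q.1‖)
    have h1 : ‖a • p.1 + c • q.1‖ ≤ a * ‖p.1‖ + c * ‖q.1‖ := by
      refine (norm_add_le _ _).trans ?_
      rw [norm_smul, norm_smul, Real.norm_of_nonneg ha, Real.norm_of_nonneg hc]
    have h2 := mul_le_mul_of_nonneg_left h1 hK0
    rcases ha.eq_or_lt with rfl | ha'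
    · have : c = 1 := by linarith
      subst this
      linarith
    · nlinarith [mul_lt_mul_of_pos_left hp' ha', mul_le_mul_of_nonneg_left hq'.le hc]
  have hA₁o : IsOpen A₁ := isOpen_lt (by fun_prop) (by fun_prop)
  have hA₂ : Convex ℝ A₂ := by
    rintro p ⟨x, hx, hp1, hp2⟩ q ⟨z, hz, hq1, hq2⟩ a c ha hc hac
    refine ⟨a • x + c • z, hφ.1 hx hz ha hc hac, ?_, ?_⟩
    · rw [affineMap_combo T hac, ← hp1, ← hq1]; rfl
    · change _ ≤ a * p.2 + c * q.2
      have h1 := hφ.2 hx hz ha hc hac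
      simp only [smul_eq_mul] at h1
      have h2 : v = a * v + c * v := by rw [← add_mul, hac, one_mul]
      nlinarith [mul_le_mul_of_nonneg_left hp2 ha, mul_le_mul_of_nonneg_left hq2 hc]
  have hdisj : Disjoint A₁ A₂ := by
    rw [Set.disjoint_left]
    rintro q hq ⟨x, hx, hq1, hq2⟩
    have hq' : q.2 < -(K * ‖q.1‖) := hq
    rw [hq1] at hq'
    have := hK x hx
    linarith
  obtain ⟨F, c, hF1, hF2⟩ := geometric_hahn_banach_open hA₁ hA₁o hA₂ hdisj
  set α := F (0, 1) with hα
  let l : W →L[ℝ] ℝ := F.comp (ContinuousLinearMap.inl ℝ W ℝ)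
  have hF : ∀ (u : W) (t : ℝ), F (u, t) = l u + t * α := by
    intro u t
    have : ((u, t) : W × ℝ) = (u, 0) + t • ((0, 1) : W × ℝ) := by simp
    rw [this, map_add, map_smul, smul_eq_mul]
    rfl
  have hneg : ∀ s : ℝ, 0 < s → -s * α < c := by
    intro s hs
    have := hF1 (0, -s) (by change -s < -(K * ‖(0 : W)‖); simpa using hs)
    rwa [hF, map_zero, zero_add] at this
  have hc : 0 ≤ c := by
    by_contra hc
    push Not at hc
    have hα0 : 0 < α := by linarith [hneg 1 one_pos]
    have := hneg (-c / (2 * α)) (div_pos (by linarith) (by linarith))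
    have h2 : -(-c / (2 * α)) * α = c / 2 := by field_simp
    linarith
  have hα0 : 0 ≤ α := by
    by_contra h
    push Not at h
    have := hneg ((c + 1) / -α) (div_pos (by linarith) (by linarith))
    have h2 : -((c + 1) / -α) * α = c + 1 := by
      rw [div_neg, neg_neg, div_mul_cancel₀ _ h.ne]
    linarith
  -- The hyperplane is not vertical: the open cone `A₁` projects onto all of `W`, so `α = 0` would
  -- make `l` smaller than `c` everywhere, also at the point `T x` where separation gives `c ≤ l (T
  -- x)`.
  have hαpos : 0 < α := by
    rcases hα0.eq_or_lt with h | h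
    · exfalso
      have hl : ∀ u, l u < c := by
        intro u
        have := hF1 (u, -(K * ‖u‖) - 1) (by change -(K * ‖u‖) - 1 < -(K * ‖u‖); linarith)
        rwa [hF, ← h, mul_zero, add_zero] at this
      obtain ⟨x, hx⟩ := hne
      have := hF2 (T x, φ x - v) ⟨x, hx, rfl, le_rfl⟩
      rw [hF, ← h, mul_zero, add_zero] at this
      linarith [hl (T x)]
    · exact h
  refine ⟨α⁻¹ • (InnerProductSpace.toDual ℝ W).symm l, fun x hx => ?_⟩
  have := hF2 (T x, φ x - v) ⟨x, hx, rfl, le_rfl⟩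
  rw [hF] at this
  rw [real_inner_smul_left, InnerProductSpace.toDual_symm_apply]
  have h1 : 0 ≤ α⁻¹ * (l (T x) + (φ x - v) * α) := mul_nonneg (by positivity) (hc.trans this)
  have h2 : α⁻¹ * (l (T x) + (φ x - v) * α) = α⁻¹ * l (T x) + (φ x - v) := by field_simp
  linarith

end Multiplier

/-- Let `t` tend to zero. This recovers the full quadratic growth at a minimizer from comparisons
along a segment. -/
theorem le_of_forall_one_sub_mul_le {N a : ℝ} (h : ∀ t : ℝ, 0 < t → t < 1 → (1 - t) * N ≤ a) :
    N ≤ a := by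
  have h1 : Filter.Tendsto (fun t : ℝ => (1 - t) * N) (nhdsWithin 0 (Set.Ioi 0)) (nhds N) := by
    have : Filter.Tendsto (fun t : ℝ => (1 - t) * N) (nhds 0) (nhds ((1 - 0) * N)) :=
      Continuous.tendsto (by fun_prop) 0
    rw [sub_zero, one_mul] at this
    exact this.mono_left nhdsWithin_le_nhds
  refine le_of_tendsto h1 ?_
  filter_upwards [Ioo_mem_nhdsGT (zero_lt_one (α := ℝ))] with t ht
  exact h t ht.1 ht.2

theorem app_combo {k d : ℕ} (M : Matrix (Fin k) (Fin d) ℝ) (a c : ℝ) (u v : Vec d) :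
    app M (a • u + c • v) = a • app M u + c • app M v := by
  simp [app]

theorem app_sub {k d : ℕ} (M : Matrix (Fin k) (Fin d) ℝ) (u v : Vec d) :
    app M (u - v) = app M u - app M v := by
  simp [app]

/-! ### Bregman distances of prox-functions. -/

section Bregman

variable {d : ℕ} {h : Vec d → ℝ} {K : Set (Vec d)} {σ : ℝ}

/-- Strong convexity of the prox-function bounds the Bregman distance from below. -/
theorem IsProxFunction.le_bregman (hh : IsProxFunction h K σ) {u v : Vec d} (hu : u ∈ K)
    (hv : v ∈ K) : σ / 2 * ‖u - v‖ ^ 2 ≤ bregman h u v := by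
  have hg : HasDerivAt (fun t : ℝ => h (v + t • (u - v))) ⟪gradient h v, u - v⟫ 0 := by
    have h1 : HasFDerivAt h (InnerProductSpace.toDual ℝ _ (gradient h v)) (v + (0 : ℝ) • (u - v)) := by
      rw [zero_smul, add_zero]
      exact (hh.2.2 v hv).hasGradientAt
    have h2 : HasDerivAt (fun t : ℝ => v + t • (u - v)) (u - v) 0 := by
      simpa using ((hasDerivAt_id (0 : ℝ)).smul_const (u - v)).const_add v
    have h3 := h1.comp_hasDerivAt (0 : ℝ) h2
    rwa [InnerProductSpace.toDual_apply_apply] at h3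
  -- Strong convexity along the segment bounds the difference quotients above by `h u - h v - (1 -
  -- t) (σ / 2) ‖u - v‖²`; their limit from the right is the gradient term.
  have hlim := hg.tendsto_slope_zero_right
  have hlim2 : Filter.Tendsto (fun t : ℝ => h u - h v - (1 - t) * (σ / 2 * ‖u - v‖ ^ 2))
      (nhdsWithin 0 (Set.Ioi 0)) (nhds (h u - h v - (1 - 0) * (σ / 2 * ‖u - v‖ ^ 2))) :=
    (Continuous.tendsto (by fun_prop) 0).mono_left nhdsWithin_le_nhds
  have := le_of_tendsto_of_tendsto hlim hlim2 (by
    filter_upwards [Ioo_mem_nhdsGT (zero_lt_one (α := ℝ))] with t ht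
    have h1 := hh.2.1.2 hu hv ht.1.le (sub_nonneg.2 ht.2.le) (by ring)
    have h2 : t • u + (1 - t) • v = v + t • (u - v) := by module
    rw [h2, smul_eq_mul, smul_eq_mul] at h1
    rw [zero_add, zero_smul, add_zero, smul_eq_mul, inv_mul_le_iff₀ ht.1]
    linarith)
  rw [bregman]
  linarith

/-- In its first argument the Bregman distance differs from `h` by an affine function, so it
inherits the strong convexity of `h`. -/
theorem IsProxFunction.bregman_combo_le (hh : IsProxFunction h K σ) {u v : Vec d} (w : Vec d)
    (hu : u ∈ K) (hv : v ∈ K) {a c : ℝ} (ha : 0 ≤ a) (hc : 0 ≤ c) (hac : a + c = 1) :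
    bregman h (a • u + c • v) w ≤
      a * bregman h u w + c * bregman h v w - a * c * (σ / 2 * ‖u - v‖ ^ 2) := by
  have h1 := hh.2.1.2 hu hv ha hc hac
  rw [smul_eq_mul, smul_eq_mul] at h1
  have h2 : a • u + c • v - w = a • (u - w) + c • (v - w) := by
    have : w = (a + c) • w := by rw [hac, one_smul]
    conv_lhs => rw [this]
    module
  have h3 : h w = a * h w + c * h w := by rw [← add_mul, hac, one_mul]
  simp only [bregman]
  rw [h2, inner_add_right, real_inner_smul_right, real_inner_smul_right]
  linarith

end Bregman

/-! ### Strong duality and the dual solution set. -/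

namespace Problem

variable {m r : ℕ} {n : Fin (r + 1) → ℕ} (P : Problem m r n)

/-- The residual as an affine map. -/
noncomputable def resAffine : Blocks n →ᵃ[ℝ] Vec m :=
  (∑ i, (Matrix.toEuclideanLin (P.A i)).comp (LinearMap.proj i)).toAffineMap -
    AffineMap.const ℝ _ P.b

theorem resAffine_apply (x : Blocks n) : P.resAffine x = P.res x := by
  simp [resAffine, res, app]

theorem res_combo {a c : ℝ} (hac : a + c = 1) (x z : Blocks n) :
    P.res (a • x + c • z) = a • P.res x + c • P.res z := by
  simp only [← resAffine_apply]
  exact affineMap_combo _ hac x z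

variable {P}

theorem Standing.convex_constraint (hP : P.Standing) : Convex ℝ P.constraint :=
  fun _ hx _ hz _ _ ha hc hac i => (hP.2.1 i).2.2 (hx i) (hz i) ha hc hac

theorem Standing.convexOn_obj (hP : P.Standing) : ConvexOn ℝ P.domain P.obj := by
  refine ⟨fun x hx z hz a c ha hc hac i => (hP.1 i).2.1.1 (hx i) (hz i) ha hc hac,
    fun x hx z hz a c ha hc hac => ?_⟩
  rw [obj, obj, obj, Finset.smul_sum, Finset.smul_sum, ← Finset.sum_add_distrib]
  exact Finset.sum_le_sum fun i _ => (hP.1 i).2.1.2 (hx i) (hz i) ha hc hac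

theorem Standing.convex_inter (hP : P.Standing) : Convex ℝ (P.constraint ∩ P.domain) :=
  hP.convex_constraint.inter hP.convexOn_obj.1

theorem optValue_eq {x : Blocks n} (hx : x ∈ P.feasible) (hmin : IsMinOn P.obj P.feasible x) :
    P.optValue = P.obj x := by
  refine IsLeast.csInf_eq ⟨⟨x, hx, rfl⟩, ?_⟩
  rintro _ ⟨z, hz, rfl⟩
  exact hmin hz

/-- Strong duality: there is a Lagrange multiplier for the coupling constraint. -/
theorem Standing.exists_multiplier (hP : P.Standing) :
    ∃ y, ∀ x ∈ P.constraint ∩ P.domain, P.optValue ≤ P.obj x + ⟪y, P.res x⟫ := by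
  obtain ⟨xo, hxo, hmin⟩ := hP.2.2.1
  have hv : ∀ x ∈ P.constraint ∩ P.domain, P.resAffine x = 0 → P.optValue ≤ P.obj x := by
    intro x hx hx0
    rw [optValue_eq hxo hmin]
    rw [resAffine_apply] at hx0
    exact hmin ⟨hx, hx0⟩
  have hconv := hP.convexOn_obj.subset Set.inter_subset_right hP.convex_inter
  obtain ⟨K, hK0, hK⟩ : ∃ K : ℝ, 0 ≤ K ∧ ∀ x ∈ P.constraint ∩ P.domain,
      P.optValue - K * ‖P.resAffine x‖ ≤ P.obj x := by
    -- In the polytope case only `dom f` needs a relative interior point, and the error bound is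
    -- taken inside its affine span. In the Slater case `𝒳` is absorbed into the domain and `Q` is
    -- the whole space.
    rcases hP.2.2.2 with ⟨⟨s, hs, hX⟩, x₀, hx₀X, hx₀, hres⟩ | ⟨x₀, hx₀, hres⟩
    · rw [← resAffine_apply] at hres
      have hx₀' : x₀ ∈ convexHull ℝ (hs.toFinset : Set (Blocks n)) := by
        rwa [hs.coe_toFinset, ← hX]
      obtain ⟨H, -, hH⟩ := exists_errorBound_convexHull P.resAffine (affineSpan ℝ P.domain)
        hs.toFinset x₀ hx₀' (subset_affineSpan ℝ _ (intrinsicInterior_subset hx₀)) hres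
      rw [hs.coe_toFinset, ← hX] at hH
      exact exists_calm_of_errorBound hP.convexOn_obj hP.convex_constraint P.resAffine hx₀X hx₀
        hres hH hv
    · rw [← resAffine_apply] at hres
      obtain ⟨H, -, hH⟩ := exists_errorBound_affineSubspace P.resAffine
        (affineSpan ℝ (P.constraint ∩ P.domain))
        (subset_affineSpan ℝ _ (intrinsicInterior_subset hx₀)) hres
      obtain ⟨K, hK0, hK⟩ := exists_calm_of_errorBound hconv convex_univ P.resAffine
        (Set.mem_univ x₀) hx₀ hres
        (fun x _ hx => (hH x hx).imp fun z hz => ⟨Set.mem_univ _, hz⟩) (v := P.optValue)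
        (fun x hx => hv x hx.2)
      exact ⟨K, hK0, fun x hx => hK x ⟨Set.mem_univ _, hx⟩⟩
  obtain ⟨y, hy⟩ := exists_multiplier_of_calm hconv ⟨xo, hxo.1⟩ P.resAffine hK0 hK
  exact ⟨y, fun x hx => by simpa only [resAffine_apply] using hy x hx⟩

/-- The dual solutions are exactly the Lagrange multipliers. -/
theorem Standing.mem_dualSolutions (hP : P.Standing) {y : Vec m} :
    y ∈ P.dualSolutions ↔
      ∀ x ∈ P.constraint ∩ P.domain, P.optValue ≤ P.obj x + ⟪y, P.res x⟫ := by
  obtain ⟨xo, hxo, hmin⟩ := hP.2.2.1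
  have hupper : ∀ z, P.dualFun z ≤ (P.optValue : EReal) := by
    intro z
    refine (iInf₂_le xo hxo.1).trans ?_
    rw [hxo.2, inner_zero_right, add_zero, optValue_eq hxo hmin]
  have hlower : ∀ z, (P.optValue : EReal) ≤ P.dualFun z ↔
      ∀ x ∈ P.constraint ∩ P.domain, P.optValue ≤ P.obj x + ⟪z, P.res x⟫ := by
    intro z
    simp only [dualFun, le_iInf_iff, EReal.coe_le_coe_iff]
  constructor
  · intro hy
    -- A multiplier attains the weak duality bound, so every maximizer must attain it too.
    obtain ⟨y₀, hy₀⟩ := hP.exists_multiplier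
    exact (hlower y).1 (((hlower y₀).2 hy₀).trans (hy y₀))
  · exact fun hy z => (hupper z).trans ((hlower y).2 hy)

/-- A dual solution of minimum norm exists. -/
theorem Standing.exists_minNorm_dualSolution (hP : P.Standing) :
    ∃ y ∈ P.dualSolutions, P.dualRadius = ‖y‖ ∧ ∀ z ∈ P.dualSolutions, ‖y‖ ≤ ‖z‖ := by
  have hclosed : IsClosed P.dualSolutions := by
    have : P.dualSolutions = ⋂ x ∈ P.constraint ∩ P.domain,
        {y | P.optValue ≤ P.obj x + ⟪y, P.res x⟫} := by
      ext y
      simp only [hP.mem_dualSolutions, Set.mem_iInter, Set.mem_ofPred_eq]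
    rw [this]
    exact isClosed_biInter fun x _ => isClosed_le continuous_const (by fun_prop)
  have hne : P.dualSolutions.Nonempty :=
    hP.exists_multiplier.imp fun y hy => hP.mem_dualSolutions.2 hy
  obtain ⟨y, hy, hdist⟩ := hclosed.exists_infDist_eq_dist hne 0
  have hmin : ∀ z ∈ P.dualSolutions, ‖y‖ ≤ ‖z‖ := by
    intro z hz
    have := Metric.infDist_le_dist_of_mem (x := 0) hz
    rwa [hdist, dist_zero_left, dist_zero_left] at this
  refine ⟨y, hy, IsLeast.csInf_eq ⟨⟨y, hy, rfl⟩, ?_⟩, hmin⟩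
  rintro _ ⟨z, hz, rfl⟩
  exact hmin z hz

end Problem

/-! ### The smoothed dual function and the excessive gap. -/

namespace Smoother

variable {m r : ℕ} {n : Fin (r + 1) → ℕ} {P : Problem m r n} {B : Smoother n} {σ L : ℝ}

theorem normSqS_sub (x z : Blocks n) :
    B.normSqS (x - z) = (∑ i : Fin r, ‖app (B.S i) (x i.castSucc) - app (B.S i) (z i.castSucc)‖ ^ 2) +
      ‖x (Fin.last r) - z (Fin.last r)‖ ^ 2 := by
  simp only [normSqS, Pi.sub_apply, app_sub]

theorem IsSmoother.le_dist (hB : B.IsSmoother P σ) {x z : Blocks n} (hx : x ∈ P.constraint)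
    (hz : z ∈ P.constraint) : σ / 2 * B.normSqS (x - z) ≤ B.dist x z := by
  rw [normSqS_sub, dist, mul_add, Finset.mul_sum]
  exact add_le_add (Finset.sum_le_sum fun i _ => (hB.2.1 i).le_bregman
    (Set.mem_image_of_mem _ (hx _)) (Set.mem_image_of_mem _ (hz _))) (hB.2.2.le_bregman (hx _) (hz _))

theorem normSqS_nonneg (x : Blocks n) : 0 ≤ B.normSqS x := by
  rw [normSqS]; positivity

theorem IsSmoother.dist_nonneg (hB : B.IsSmoother P σ) (hσ : 0 < σ) {x z : Blocks n}
    (hx : x ∈ P.constraint) (hz : z ∈ P.constraint) : 0 ≤ B.dist x z :=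
  (mul_nonneg (by positivity) (normSqS_nonneg _)).trans (hB.le_dist hx hz)

theorem IsSmoother.dist_combo_le (hB : B.IsSmoother P σ) {x z : Blocks n} (w : Blocks n)
    (hx : x ∈ P.constraint) (hz : z ∈ P.constraint) {a c : ℝ} (ha : 0 ≤ a) (hc : 0 ≤ c)
    (hac : a + c = 1) : B.dist (a • x + c • z) w ≤
      a * B.dist x w + c * B.dist z w - a * c * (σ / 2 * B.normSqS (x - z)) := by
  have h1 := Finset.sum_le_sum fun i (_ : i ∈ (Finset.univ : Finset (Fin r))) =>
    (hB.2.1 i).bregman_combo_le (app (B.S i) (w i.castSucc))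
      (Set.mem_image_of_mem _ (hx i.castSucc)) (Set.mem_image_of_mem _ (hz i.castSucc)) ha hc hac
  have h2 := hB.2.2.bregman_combo_le (w (Fin.last r)) (hx _) (hz _) ha hc hac
  rw [Finset.sum_sub_distrib, Finset.sum_add_distrib, ← Finset.mul_sum, ← Finset.mul_sum,
    ← Finset.mul_sum, ← Finset.mul_sum] at h1
  rw [normSqS_sub]
  simp only [dist, Pi.add_apply, Pi.smul_apply, app_combo]
  linarith

/-- Quadratic growth of the smoothed Lagrangian at its minimizer. -/
theorem IsSmoothedMin.growth (hP : P.Standing) (hB : B.IsSmoother P σ) {γ : ℝ} (hγ : 0 ≤ γ)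
    {y : Vec m} {xs z : Blocks n} (hxs : B.IsSmoothedMin P γ y xs)
    (hz : z ∈ P.constraint ∩ P.domain) :
    P.obj xs + ⟪y, P.res xs⟫ + γ * B.dist xs B.center + γ * (σ / 2 * B.normSqS (z - xs)) ≤
      P.obj z + ⟪y, P.res z⟫ + γ * B.dist z B.center := by
  suffices h : γ * (σ / 2 * B.normSqS (z - xs)) ≤
      P.obj z + ⟪y, P.res z⟫ + γ * B.dist z B.center -
        (P.obj xs + ⟪y, P.res xs⟫ + γ * B.dist xs B.center) by linarith
  refine le_of_forall_one_sub_mul_le fun t ht0 ht1 => ?_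
  have ht : 0 ≤ 1 - t := by linarith
  -- Compare `xs` with `t z + (1 - t) xs`: strong convexity contributes `t (1 - t)` times the
  -- quadratic term, and `t` is divided out.
  have hmin := hxs.2 (hP.convex_inter hz hxs.1 ht0.le ht (by ring))
  simp only [Set.mem_ofPred_eq] at hmin
  have h1 := hP.convexOn_obj.2 hz.2 hxs.1.2 ht0.le ht (by ring)
  have h2 := mul_le_mul_of_nonneg_left
    (hB.dist_combo_le B.center hz.1 hxs.1.1 ht0.le ht (by ring)) hγ
  rw [P.res_combo (by ring), inner_add_right, real_inner_smul_right, real_inner_smul_right] at hmin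
  simp only [smul_eq_mul] at h1
  refine le_of_mul_le_mul_left ?_ ht0
  linarith

/-- The smoothed dual function is bounded below by its quadratic model. -/
theorem IsSmoothedMin.quadratic_model_le (hP : P.Standing) (hB : B.IsSmoother P σ)
    (hL : B.IsSmoothingConstant P σ L) {γ : ℝ} (hγ : 0 < γ) {y : Vec m} {xs z : Blocks n}
    (hxs : B.IsSmoothedMin P γ y xs) (hz : z ∈ P.constraint ∩ P.domain) (e : Vec m) :
    P.obj xs + ⟪y, P.res xs⟫ + γ * B.dist xs B.center + ⟪e, P.res xs⟫ - L / (2 * γ) * ‖e‖ ^ 2 ≤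
      P.obj z + ⟪y + e, P.res z⟫ + γ * B.dist z B.center := by
  have hL0 := hL.1
  have h1 := hxs.growth hP hB hγ.le hz
  have h2 := hL.2 z hz.1 xs hxs.1.1
  -- Completing this square absorbs the cross term `⟪e, P.res z - P.res xs⟫` into the quadratic
  -- growth, at the price `L / (2γ) ‖e‖²`.
  have h3 : 0 ≤ ‖γ • (P.res z - P.res xs) + L • e‖ ^ 2 := by positivity
  rw [norm_add_sq_real, norm_smul, norm_smul, real_inner_smul_left, real_inner_smul_right,
    Real.norm_of_nonneg hγ.le, Real.norm_of_nonneg hL0.le] at h3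
  have h4 : γ / (2 * L) * ‖P.res z - P.res xs‖ ^ 2 ≤ γ * (σ / 2 * B.normSqS (z - xs)) := by
    calc _ ≤ γ / (2 * L) * (σ * L * B.normSqS (z - xs)) := by gcongr
      _ = _ := by field_simp
  have h5 : 0 ≤ γ / (2 * L) * ‖P.res z - P.res xs‖ ^ 2 + ⟪P.res z - P.res xs, e⟫ +
      L / (2 * γ) * ‖e‖ ^ 2 := by
    have : γ / (2 * L) * ‖P.res z - P.res xs‖ ^ 2 + ⟪P.res z - P.res xs, e⟫ +
      L / (2 * γ) * ‖e‖ ^ 2 = ((γ * ‖P.res z - P.res xs‖) ^ 2 +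
        2 * (γ * (L * ⟪P.res z - P.res xs, e⟫)) + (L * ‖e‖) ^ 2) / (2 * L * γ) := by
      field_simp
    rw [this]
    positivity
  rw [inner_sub_left, real_inner_comm, real_inner_comm e (P.res xs)] at h5
  rw [inner_add_left]
  linarith

/-- The excessive gap condition `f(x) + ‖A x - b‖² / (2β) ≤ g_γ(y)`, where `g_γ` is the smoothed
dual function. -/
def ExcessiveGap (B : Smoother n) (P : Problem m r n) (γ β : ℝ) (x : Blocks n) (y : Vec m) : Prop :=
  x ∈ P.constraint ∩ P.domain ∧ ∀ z ∈ P.constraint ∩ P.domain,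
    P.obj x + ‖P.res x‖ ^ 2 / (2 * β) ≤ P.obj z + ⟪y, P.res z⟫ + γ * B.dist z B.center

/-- Quadratic model at `y = 0` with increment `β⁻¹ (A x₀ - b)`: as `L / γ = β`, the quadratic loss
is half of the linear gain, and the other half is the penalty. -/
theorem excessiveGap_of_isSmoothedMin (hP : P.Standing) (hB : B.IsSmoother P σ) (hσ : 0 < σ)
    (hL : B.IsSmoothingConstant P σ L) {γ β : ℝ} (hγ : 0 < γ) (hβ : 0 < β) (hγβ : γ * β = L)
    {x₀ : Blocks n} (hx₀ : B.IsSmoothedMin P γ 0 x₀) :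
    B.ExcessiveGap P γ β x₀ (β⁻¹ • P.res x₀) := by
  refine ⟨hx₀.1, fun z hz => ?_⟩
  have h1 := hx₀.quadratic_model_le hP hB hL hγ hz (β⁻¹ • P.res x₀)
  have h2 := mul_nonneg hγ.le (hB.dist_nonneg hσ hx₀.1.1 hB.1)
  rw [inner_zero_left, zero_add, real_inner_smul_left, real_inner_self_eq_norm_sq, norm_smul,
    norm_inv, Real.norm_of_nonneg hβ.le, ← hγβ] at h1
  have h3 : γ * β / (2 * γ) * (β⁻¹ * ‖P.res x₀‖) ^ 2 = ‖P.res x₀‖ ^ 2 / (2 * β) := by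
    field_simp
  have h4 : β⁻¹ * ‖P.res x₀‖ ^ 2 = ‖P.res x₀‖ ^ 2 / (2 * β) + ‖P.res x₀‖ ^ 2 / (2 * β) := by
    field_simp; ring
  rw [h3, h4] at h1
  linarith

/-- With `σ = 1` and `L / β = γ`, the quadratic term of the proximal step lies below `γ` times the
Bregman distance, so its minimum bounds the smoothed dual function from below. -/
theorem excessiveGap_of_isProxStep (hB : B.IsSmoother P 1) (hL : B.IsSmoothingConstant P 1 L)
    {γ β : ℝ} (hγ : 0 < γ) (hβ : 0 < β) (hγβ : γ * β = L) {x₀ : Blocks n}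
    (hx₀ : B.IsProxStep P L β (β⁻¹ • P.res B.center) x₀) :
    B.ExcessiveGap P γ β x₀ (β⁻¹ • P.res B.center) := by
  refine ⟨hx₀.1, fun z hz => ?_⟩
  have h1 := hx₀.2 hz
  simp only [Set.mem_ofPred_eq, inner_sub_right, real_inner_smul_left] at h1
  have h2 := hL.2 x₀ hx₀.1.1 B.center hB.1
  have h3 := mul_le_mul_of_nonneg_left (hB.le_dist hz.1 hB.1) hγ.le
  rw [norm_sub_sq_real, real_inner_comm, one_mul] at h2
  rw [real_inner_self_eq_norm_sq] at h1
  rw [real_inner_smul_left]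
  have hLβ : L / (2 * β) = γ / 2 := by rw [← hγβ]; field_simp
  have h4 : ‖P.res x₀‖ ^ 2 / (2 * β) ≤ γ / 2 * B.normSqS (x₀ - B.center) +
      β⁻¹ * ⟪P.res B.center, P.res x₀⟫ - ‖P.res B.center‖ ^ 2 / (2 * β) := by
    have : γ / 2 * B.normSqS (x₀ - B.center) +
      β⁻¹ * ⟪P.res B.center, P.res x₀⟫ - ‖P.res B.center‖ ^ 2 / (2 * β) =
      (L * B.normSqS (x₀ - B.center) + 2 * ⟪P.res B.center, P.res x₀⟫ - ‖P.res B.center‖ ^ 2) /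
        (2 * β) := by
      rw [← hγβ]; field_simp
    rw [this]
    gcongr
    linarith
  have h5 : 0 ≤ ‖P.res B.center‖ ^ 2 / (2 * β) := by positivity
  rw [hLβ] at h1
  linarith

/-- One primal and two dual steps maintain the excessive gap condition. -/
theorem ExcessiveGap.step (hP : P.Standing) (hB : B.IsSmoother P σ) (hσ : 0 < σ)
    (hL : B.IsSmoothingConstant P σ L) {γ γ' β τ : ℝ} (hγ' : 0 < γ') (hβ : 0 < β) (hτ0 : 0 < τ)
    (hτ1 : τ < 1) (hγγ' : (1 - τ) * γ ≤ γ') (hτ : L * τ ^ 2 ≤ (1 - τ) * β * γ')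
    {x xs : Blocks n} {y yh : Vec m} (hgap : B.ExcessiveGap P γ β x y)
    (hyh : yh = (1 - τ) • y + τ • (β⁻¹ • P.res x)) (hxs : B.IsSmoothedMin P γ' yh xs) :
    B.ExcessiveGap P γ' ((1 - τ) * β) ((1 - τ) • x + τ • xs) (yh + (γ' / L) • P.res xs) := by
  have ht : 0 < 1 - τ := by linarith
  have hL0 := hL.1
  refine ⟨hP.convex_inter hgap.1 hxs.1 ht.le hτ0.le (by ring), fun z hz => ?_⟩
  refine le_trans ?_ (hxs.quadratic_model_le hP hB hL hγ' hz _)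
  have h1 := mul_le_mul_of_nonneg_left (hgap.2 xs hxs.1) ht.le
  have h2 := hP.convexOn_obj.2 hgap.1.2 hxs.1.2 ht.le hτ0.le (by ring)
  simp only [smul_eq_mul] at h2
  have h3 := mul_le_mul_of_nonneg_right hγγ' (hB.dist_nonneg hσ hxs.1.1 hB.1)
  have h4 : ⟪yh, P.res xs⟫ = (1 - τ) * ⟪y, P.res xs⟫ + τ * (β⁻¹ * ⟪P.res x, P.res xs⟫) := by
    rw [hyh, inner_add_left, real_inner_smul_left, real_inner_smul_left, real_inner_smul_left]
  -- The cross term here is exactly the one that `yh` produces in `h4`, which explains the choice of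
  -- `yh`. The remaining `‖P.res xs‖²` is paid for by the dual gradient step, by `hτ`.
  have h5 : ‖(1 - τ) • P.res x + τ • P.res xs‖ ^ 2 / (2 * ((1 - τ) * β)) =
      (1 - τ) * (‖P.res x‖ ^ 2 / (2 * β)) + τ * (β⁻¹ * ⟪P.res x, P.res xs⟫) +
        τ ^ 2 / (2 * ((1 - τ) * β)) * ‖P.res xs‖ ^ 2 := by
    rw [norm_add_sq_real, norm_smul, norm_smul, real_inner_smul_left, real_inner_smul_right,
      Real.norm_of_nonneg ht.le, Real.norm_of_nonneg hτ0.le]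
    field_simp
  have h6 : τ ^ 2 / (2 * ((1 - τ) * β)) ≤ γ' / (2 * L) := by
    rw [div_le_div_iff₀ (by positivity) (by positivity)]
    linarith
  have h7 := mul_le_mul_of_nonneg_right h6 (sq_nonneg ‖P.res xs‖)
  rw [P.res_combo (by ring), h5, real_inner_smul_left, real_inner_self_eq_norm_sq, norm_smul,
    Real.norm_of_nonneg (by positivity), h4]
  have h8 : γ' / L * ‖P.res xs‖ ^ 2 - L / (2 * γ') * (γ' / L * ‖P.res xs‖) ^ 2 =
      γ' / (2 * L) * ‖P.res xs‖ ^ 2 := by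
    field_simp; ring
  linarith

end Smoother

/-! ### Closed forms of the parameters and the invariant along the scheme. -/

theorem gam_eq (L : ℝ) (k : ℕ) : gam L k = 2 * √L / ((k : ℝ) + 2) := by
  induction k with
  | zero => simp [gam]
  | succ k ih =>
    have : (k : ℝ) + 2 + 1 ≠ 0 := by positivity
    rw [gam, ih, tau]
    push_cast
    field_simp
    ring

theorem bet_eq (L : ℝ) (k : ℕ) : bet L k = √L / ((k : ℝ) + 1) := by
  induction k with
  | zero => simp [bet]
  | succ k ih =>
    rw [bet, ih, tau]
    push_cast
    field_simp
    ring

namespace Smoother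

variable {m r : ℕ} {n : Fin (r + 1) → ℕ} {P : Problem m r n} {B : Smoother n} {σ L : ℝ}

/-- The excessive gap condition holds along the scheme with one primal and two dual steps. -/
theorem IsGenerated.excessiveGap (hP : P.Standing) (hB : B.IsSmoother P σ) (hσ : 0 < σ)
    (hL : B.IsSmoothingConstant P σ L) {x : ℕ → Blocks n} {y : ℕ → Vec m}
    (hxy : B.IsGenerated P σ L x y) (k : ℕ) :
    B.ExcessiveGap P (gam L k) (bet L k) (x k) (y k) := by
  have hs : 0 < √L := Real.sqrt_pos.2 hL.1
  have hsq : √L * √L = L := Real.mul_self_sqrt hL.1.le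
  induction k with
  | zero =>
    rcases hxy.1 with ⟨hx₀, hy₀⟩ | ⟨rfl, hy₀, hx₀⟩
    · rw [hy₀]
      exact excessiveGap_of_isSmoothedMin hP hB hσ hL hs hs hsq hx₀
    · rw [hy₀] at hx₀ ⊢
      exact excessiveGap_of_isProxStep hB hL hs hs hsq hx₀
  | succ k ih =>
    obtain ⟨xs, hxs, hx, hy⟩ := hxy.2 k
    rw [hx, hy]
    have hk : (0 : ℝ) ≤ k := k.cast_nonneg
    have hτ0 : 0 < tau k := by rw [tau]; positivity
    have hτ1 : tau k < 1 := by rw [tau, div_lt_one (by positivity)]; linarith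
    refine ih.step hP hB hσ hL (τ := tau k) ?_ ?_ hτ0 hτ1 ?_ ?_ rfl hxs
    · rw [gam_eq]; positivity
    · rw [bet_eq]; positivity
    · rw [gam]
      have h1 : tau k / (1 + tau k) ≤ tau k := div_le_self hτ0.le (by linarith)
      exact mul_le_mul_of_nonneg_right (by linarith) (by rw [gam_eq]; positivity)
    -- After cancelling `L`, the condition reads `1 / (k + 2)² ≤ 2 / ((k + 2) (k + 3))`, that is, `k
    -- + 3 ≤ 2 (k + 2)`.
    · have h1 : (1 - tau k) * bet L k = bet L (k + 1) := rfl
      rw [h1, bet_eq, gam_eq, tau]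
      push_cast
      have h2 : √L / ((k : ℝ) + 1 + 1) * (2 * √L / ((k : ℝ) + 1 + 2)) =
          L * (2 / ((k + 2) * (k + 3))) := by
        rw [mul_div_assoc', div_mul_eq_mul_div, mul_left_comm, hsq]; field_simp; ring
      rw [h2]
      refine mul_le_mul_of_nonneg_left ?_ hL.1.le
      rw [div_pow, one_pow, div_le_div_iff₀ (by positivity) (by positivity)]
      nlinarith

end Smoother

/-! ### Convergence rates. -/

/-- A quadratic inequality `s² ≤ 2β(D s + G)` bounds `s`. -/
theorem le_of_sq_le {s β D G : ℝ} (hβ : 0 ≤ β) (hD : 0 ≤ D) (hG : 0 ≤ G)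
    (h : s ^ 2 ≤ 2 * β * (D * s + G)) : s ≤ 2 * β * D + √(2 * β * G) := by
  have hq : √(2 * β * G) ^ 2 = 2 * β * G := Real.sq_sqrt (by positivity)
  have hq0 : 0 ≤ √(2 * β * G) := Real.sqrt_nonneg _
  have hβD : 0 ≤ β * D := by positivity
  -- If `s > 2βD + q` with `q = √(2βG)`, then `s (s - 2βD) > q²`.
  by_contra hlt
  push Not at hlt
  nlinarith

end SepConvex

theorem corollary5p2 {m r : ℕ} {n : Fin (r + 1) → ℕ}
    (P : SepConvex.Problem m r n) (hP : P.Standing)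
    (B : SepConvex.Smoother n) (σ : ℝ) (hσ : 0 < σ) (hB : B.IsSmoother P σ)
    (Lf : NNReal)
    (hdom : P.dom (Fin.last r) = Set.univ)
    (hf : SepConvex.IsLipschitzGradient Lf (P.f (Fin.last r)))
    (hA : ∀ μ ∈ spectrum ℝ ((P.A (Fin.last r)).transpose * P.A (Fin.last r)), 0 < μ)
    (hh : SepConvex.IsLipschitzGradient 1 B.hLast)
    (hD : BddAbove (B.proxValues P))
    (L : ℝ) (hL : B.IsSmoothingConstant P σ L)
    (x : ℕ → SepConvex.Blocks n) (y : ℕ → SepConvex.Vec m)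
    (hxy : B.IsGenerated P σ L x y)
    (hinactive : ∀ k, B.LastInactive P (SepConvex.gam L (k + 1))
      (SepConvex.Smoother.yHat P L x y k)) :
    IsLeast ((fun z => ‖z‖) '' P.dualSolutions) P.dualRadius ∧
    ∀ k : ℕ,
      x k ∈ P.constraint ∩ P.domain ∧
      ‖P.res (x k)‖ ≤
        2 * √(2 * L) * (P.dualRadius + √(B.proxDiameter P)) / ((k : ℝ) + 1) ∧
      -P.dualRadius * ‖P.res (x k)‖ ≤ P.obj (x k) - P.optValue ∧
      P.obj (x k) - P.optValue ≤ 2 * √(2 * L) / ((k : ℝ) + 1) * B.proxDiameter P := by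
  have hs : 0 < √L := Real.sqrt_pos.2 hL.1
  obtain ⟨y₀, hy₀, hrad, hmin⟩ := hP.exists_minNorm_dualSolution
  refine ⟨⟨⟨y₀, hy₀, hrad.symm⟩, ?_⟩, fun k => ?_⟩
  · rintro _ ⟨z, hz, rfl⟩
    rw [hrad]
    exact hmin z hz
  obtain ⟨xo, hxo, hxmin⟩ := hP.2.2.1
  obtain ⟨hxk, hgap⟩ := hxy.excessiveGap hP hB hσ hL k
  have hD0 : 0 ≤ B.proxDiameter P :=
    (hB.dist_nonneg hσ hxo.1.1 hB.1).trans (le_csSup hD ⟨xo, hxo.1.1, _, hB.1, rfl⟩)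
  have hR0 : 0 ≤ P.dualRadius := by rw [hrad]; exact norm_nonneg _
  have hk : (0 : ℝ) ≤ k := k.cast_nonneg
  have hβ : 0 < SepConvex.bet L k := by rw [SepConvex.bet_eq]; positivity
  have hγ : 0 < SepConvex.gam L k := by rw [SepConvex.gam_eq]; positivity
  have hupper : P.obj (x k) + ‖P.res (x k)‖ ^ 2 / (2 * SepConvex.bet L k) ≤
      P.optValue + SepConvex.gam L k * B.proxDiameter P := by
    refine (hgap xo hxo.1).trans ?_
    rw [hxo.2, inner_zero_right, add_zero, SepConvex.Problem.optValue_eq hxo hxmin]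
    gcongr
    exact le_csSup hD ⟨xo, hxo.1.1, _, hB.1, rfl⟩
  have hlower : P.optValue ≤ P.obj (x k) + P.dualRadius * ‖P.res (x k)‖ := by
    refine (hP.mem_dualSolutions.1 hy₀ _ hxk).trans ?_
    rw [hrad]
    gcongr
    exact real_inner_le_norm _ _
  -- Both rates come out with `√L`; the factor `√2` in the stated constants is slack.
  have hsqrt : √L ≤ √(2 * L) := Real.sqrt_le_sqrt (by linarith [hL.1])
  refine ⟨hxk, ?_, by linarith, ?_⟩
  · have h1 : ‖P.res (x k)‖ ^ 2 ≤ 2 * SepConvex.bet L k *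
        (P.dualRadius * ‖P.res (x k)‖ + SepConvex.gam L k * B.proxDiameter P) := by
      rw [← div_le_iff₀' (by positivity)]
      linarith
    refine (SepConvex.le_of_sq_le hβ.le hR0 (by positivity) h1).trans ?_
    have h2 : √(2 * SepConvex.bet L k * (SepConvex.gam L k * B.proxDiameter P)) ≤
        2 * √L / ((k : ℝ) + 1) * √(B.proxDiameter P) := by
      refine Real.sqrt_le_iff.2 ⟨by positivity, ?_⟩
      rw [mul_pow, Real.sq_sqrt hD0, ← mul_assoc]
      refine mul_le_mul_of_nonneg_right ?_ hD0
      -- Weakening `k + 2` to `k + 1` makes `2 β_k γ_k` at most the perfect square `(2√L / (k +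
      -- 1))²`.
      have h3 : SepConvex.gam L k ≤ 2 * √L / ((k : ℝ) + 1) := by
        rw [SepConvex.gam_eq]
        gcongr
        norm_num
      calc 2 * SepConvex.bet L k * SepConvex.gam L k
          ≤ 2 * SepConvex.bet L k * (2 * √L / ((k : ℝ) + 1)) := by gcongr
        _ = (2 * √L / ((k : ℝ) + 1)) ^ 2 := by rw [SepConvex.bet_eq]; ring
    calc 2 * SepConvex.bet L k * P.dualRadius +
          √(2 * SepConvex.bet L k * (SepConvex.gam L k * B.proxDiameter P))
        ≤ 2 * SepConvex.bet L k * P.dualRadius +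
          2 * √L / ((k : ℝ) + 1) * √(B.proxDiameter P) := by gcongr
      _ = 2 * √L * (P.dualRadius + √(B.proxDiameter P)) / ((k : ℝ) + 1) := by
          rw [SepConvex.bet_eq]; ring
      _ ≤ _ := by gcongr
  · have h1 : 0 ≤ ‖P.res (x k)‖ ^ 2 / (2 * SepConvex.bet L k) := by positivity
    have h2 : SepConvex.gam L k ≤ 2 * √(2 * L) / ((k : ℝ) + 1) := by
      rw [SepConvex.gam_eq]
      gcongr
      norm_num
    linarith [mul_le_mul_of_nonneg_right h2 hD0]
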